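/- A set $C\subset(0,\infty)$ \emph{condensates to $\infty$} if $C\cap(r,\infty)$ is uncountable for every $r\in\mathbb R$. A function $f:\mathbb R^2\to\mathbb R$ is \emph{vertically rigid for $C$} if for every $c\in C$ there is an isometry $\varphi$ of $\mathbb R^3$ with $\varphi(\mathrm{graph}(f))=\mathrm{graph}(cf)$. Put $$S_f=\left\{\frac{p-q}{|p-q|} : p,q\in\mathrm{graph}(f),\ p\neq q\right\}\subset\mathbb S^2 .$$ A great circle of $\mathbb S^2$ is \emph{vertical} if it contains $(0,0,\pm1)$. Identify $\mathbb S^1$ with the equator $\{z=0\}$ of $\mathbb S^2$. For $x\in\mathbb S^1$ let $h_3(x)$ be the third coordinate of the top endpoint of the arc in which $S_f$ meets the half great circle joining $(0,0,1)$ to $(0,0,-1)$ through $x$, i.e. the supremum of the third coordinates of the points of $S_f$ on that half great circle. For $J\subset\mathbb S^1$ let $Q(J)$ be the union of the closed quarter great circles joining the points of $J$ to $(0,0,1)$. \textbf{Theorem.} Let $C\subset(0,\infty)$ condensate to $\infty$, and let $f:\mathbb R^2\to\mathbb R$ be continuous and vertically rigid for $C$. Then one of the following holds. (A) There is a vertical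 great circle that intersects $S_f$ in exactly two points. (B) $S_f=\mathbb S^2\setminus\{(0,0,1),(0,0,-1)\}$. (C) There is $x_0\in\mathbb S^1$ such that $h_3(x_0)=0$ and $h_3(x)=1$ for every $x\in\mathbb S^1\setminus\{x_0\}$; that is, $S_f$ is $\mathbb S^2$ minus the two quarters of a great circle $Q(\{x_0\})$ and $-Q(\{x_0\})$, up to the endpoints $\pm x_0$ of these arcs, which may or may not belong to $S_f$. (D) There is a closed arc $I\subset\mathbb S^1$ with $0<\mathrm{length}(I)<\pi$ such that $h_3(x)=0$ for $x\in I$ and $h_3(x)=1$ for $x\in\mathbb S^1\setminus I$; that is, $S_f$ is $\mathbb S^2$ minus the two spherical triangles $Q(I)$ and $-Q(I)$, up to the points of the edges $I$ and $-I$ on the equator, which may or may not belong to $S_f$. -/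

import Mathlib

open scoped Pointwise

namespace VertRigid

/-- The plane with its Euclidean norm. -/
abbrev Plane : Type := EuclideanSpace ℝ (Fin 2)

/-- Three-space with its Euclidean norm. -/
abbrev Space : Type := EuclideanSpace ℝ (Fin 3)

/-- `graph f = {(x, y, z) : z = f (x, y)}`. -/
def graph (f : Plane → ℝ) : Set Space :=
  {p | p 2 = f !₂[p 0, p 1]}

/-- `C` condensates to `∞`: it is a set of positive reals and `C ∩ (r, ∞)` is uncountable
for every real `r`. -/
def CondensatesToInfty (C : Set ℝ) : Prop :=
  C ⊆ Set.Ioi 0 ∧ ∀ r : ℝ, ¬ (C ∩ Set.Ioi r).Countable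

/-- `f` is vertically rigid for `C`: for every `c ∈ C` some isometry of three-space maps
`graph f` onto `graph (c f)`. -/
def VerticallyRigidFor (f : Plane → ℝ) (C : Set ℝ) : Prop :=
  ∀ c ∈ C, ∃ φ : Space ≃ᵢ Space, φ '' graph f = graph (fun x => c * f x)

/-- The unit circle in the plane. -/
def circle : Set Plane := Metric.sphere 0 1

/-- The unit sphere in three-space. -/
def sphere : Set Space := Metric.sphere 0 1

/-- The point `(0, 0, 1)`. -/
noncomputable def northPole : Space := !₂[0, 0, 1]

/-- `S_f`: the set of directions between pairs of distinct points of the graph. -/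
def directions (f : Plane → ℝ) : Set Space :=
  {v | ∃ p ∈ graph f, ∃ q ∈ graph f, p ≠ q ∧ v = ‖p - q‖⁻¹ • (p - q)}

/-- A vertical great circle: the intersection of the unit sphere with a two-dimensional linear
subspace, containing the poles `(0, 0, ±1)`. -/
def IsVerticalGreatCircle (K : Set Space) : Prop :=
  (∃ W : Submodule ℝ Space, Module.finrank ℝ W = 2 ∧ K = (W : Set Space) ∩ sphere) ∧
    northPole ∈ K ∧ -northPole ∈ K

/-- The closed half great circle that connects the two poles through the point `(x, 0)` of the
equator. -/
def halfGreatCircle (x : Plane) : Set Space :=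
  {p | p ∈ sphere ∧ ∃ r : ℝ, 0 ≤ r ∧ p 0 = r * x 0 ∧ p 1 = r * x 1}

/-- `h₃(x)`: the height (third coordinate) of the top endpoint of the arc in which `S_f` meets
the half great circle through `x`. -/
noncomputable def topHeight (f : Plane → ℝ) (x : Plane) : ℝ :=
  sSup ((fun p : Space => p 2) '' (directions f ∩ halfGreatCircle x))

/-- The arc `{(cos t, sin t) : a ≤ t ≤ b}` of the unit circle. -/
noncomputable def circleArc (a b : ℝ) : Set Plane :=
  (fun t : ℝ => !₂[Real.cos t, Real.sin t]) '' Set.Icc a b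

/-- The union of the closed quarter great circles from the points `x ∈ J` of the equator to the
north pole. For `J` a point this is a quarter of a great circle, for `J` an arc it is a spherical
triangle. -/
def quarters (J : Set Plane) : Set Space :=
  {p | 0 ≤ p 2 ∧ ∃ x ∈ J, p ∈ halfGreatCircle x}

/-- The part of `quarters J` strictly above the equator. -/
def openQuarters (J : Set Plane) : Set Space :=
  {p | 0 < p 2 ∧ ∃ x ∈ J, p ∈ halfGreatCircle x}

/-- `S` is the sphere minus the two antipodal regions `quarters J` and `-quarters J`, where the
edges of these regions that lie on the equator may or may not belong to `S`. -/
def IsSphereMinusQuarters (S : Set Space) (J : Set Plane) : Prop :=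
  sphere \ (quarters J ∪ -quarters J) ⊆ S ∧ S ⊆ sphere \ (openQuarters J ∪ -openQuarters J)

/-- Some vertical great circle meets `S_f` in exactly two points. -/
def CaseA (f : Plane → ℝ) : Prop :=
  ∃ K : Set Space, IsVerticalGreatCircle K ∧ (K ∩ directions f).ncard = 2

/-- `S_f` is the sphere minus the two poles. -/
def CaseB (f : Plane → ℝ) : Prop :=
  directions f = sphere \ {northPole, -northPole}

/-- `S_f` is the sphere minus two quarters of a great circle. -/
def CaseC (f : Plane → ℝ) : Prop :=
  ∃ x₀ ∈ circle, topHeight f x₀ = 0 ∧ (∀ x ∈ circle, x ≠ x₀ → topHeight f x = 1) ∧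
    IsSphereMinusQuarters (directions f) {x₀}

/-- `S_f` is the sphere minus two spherical triangles. -/
def CaseD (f : Plane → ℝ) : Prop :=
  ∃ a b : ℝ, 0 < b - a ∧ b - a < Real.pi ∧
    (∀ x ∈ circleArc a b, topHeight f x = 0) ∧
    (∀ x ∈ circle, x ∉ circleArc a b → topHeight f x = 1) ∧
    IsSphereMinusQuarters (directions f) (circleArc a b)

end VertRigid

open scoped Pointwise

namespace VertRigid

/-! Let E be `slopeEpigraph f`, the set of (v, z) such that every slope of f along v is at most z.
It is a closed convex cone containing the upward vertical ray. By the intermediate value theorem a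
direction outside E and -E is a chord direction, so E ∪ -E is the closure of the complement of the
chord cone (`closure_compl_chordCone`). The linear part of an isometry between graphs therefore
respects these double cones.

If E contains a line, f is affine with one common slope along parallel lines, which is (A).
Otherwise E \ {0} is connected, and rigidity makes E congruent to its vertical stretch by c, for
arbitrarily large c. Two consequences follow as c → ∞. A point of E below the horizontal would make
the stretches contain almost opposite vectors, and pulling these back gives a line in E
(`CongruentMultiples.nonneg`). A limit of the congruences maps E into the part of E above its own
horizontal section; by recurrence of isometries that part is all of E (`subset_of_isometry_mapsTo`).

So E is a planar cone times the upper half-line. The planar cone is closed, convex and pointed: the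
origin, a ray, or a sector of angle less than π, giving (B), (C), (D). -/

/-! ### Horizontal and vertical coordinates -/

/-- The horizontal part of a point of three-space. -/
noncomputable def horiz (p : Space) : Plane := !₂[p 0, p 1]

/-- The point of three-space with horizontal part `v` and height `z`. -/
noncomputable def lift (v : Plane) (z : ℝ) : Space := !₂[v 0, v 1, z]

@[simp] lemma horiz_zero_coord (p : Space) : horiz p 0 = p 0 := by simp [horiz]
@[simp] lemma horiz_one_coord (p : Space) : horiz p 1 = p 1 := by simp [horiz]
@[simp] lemma lift_zero_coord (v : Plane) (z : ℝ) : lift v z 0 = v 0 := by simp [lift]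
@[simp] lemma lift_one_coord (v : Plane) (z : ℝ) : lift v z 1 = v 1 := by simp [lift]
@[simp] lemma lift_two_coord (v : Plane) (z : ℝ) : lift v z 2 = z := by simp [lift]

lemma plane_ext {v w : Plane} (h0 : v 0 = w 0) (h1 : v 1 = w 1) : v = w := by
  ext i; fin_cases i <;> assumption

lemma space_ext {p q : Space} (h0 : p 0 = q 0) (h1 : p 1 = q 1) (h2 : p 2 = q 2) : p = q := by
  ext i; fin_cases i <;> assumption

@[simp] lemma horiz_lift (v : Plane) (z : ℝ) : horiz (lift v z) = v :=
  plane_ext (by simp) (by simp)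

@[simp] lemma lift_horiz (p : Space) : lift (horiz p) (p 2) = p :=
  space_ext (by simp) (by simp) (by simp)

@[simp] lemma horiz_add (p q : Space) : horiz (p + q) = horiz p + horiz q :=
  plane_ext (by simp) (by simp)

@[simp] lemma horiz_smul (r : ℝ) (p : Space) : horiz (r • p) = r • horiz p :=
  plane_ext (by simp) (by simp)

@[simp] lemma horiz_neg (p : Space) : horiz (-p) = -horiz p :=
  plane_ext (by simp) (by simp)

@[simp] lemma horiz_zero : horiz 0 = 0 := plane_ext (by simp) (by simp)

lemma smul_lift (r : ℝ) (v : Plane) (z : ℝ) : r • lift v z = lift (r • v) (r * z) :=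
  space_ext (by simp) (by simp) (by simp)

lemma neg_lift (v : Plane) (z : ℝ) : -lift v z = lift (-v) (-z) :=
  space_ext (by simp) (by simp) (by simp)

lemma lift_add (v w : Plane) (y z : ℝ) : lift v y + lift w z = lift (v + w) (y + z) :=
  space_ext (by simp) (by simp) (by simp)

lemma lift_eq_zero {v : Plane} {z : ℝ} : lift v z = 0 ↔ v = 0 ∧ z = 0 := by
  constructor
  · intro h
    have h0 := congrArg (fun p : Space => p 0) h
    have h1 := congrArg (fun p : Space => p 1) h
    have h2 := congrArg (fun p : Space => p 2) h
    simp at h0 h1 h2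
    exact ⟨plane_ext (by simpa using h0) (by simpa using h1), h2⟩
  · rintro ⟨rfl, rfl⟩
    exact space_ext (by simp) (by simp) (by simp)

lemma northPole_eq : northPole = lift 0 1 := space_ext (by simp [northPole])
  (by simp [northPole]) (by simp [northPole])

lemma continuous_coord (i : Fin 3) : Continuous fun p : Space => p i := by fun_prop

lemma continuous_horiz : Continuous horiz := by
  unfold horiz; fun_prop

lemma continuous_lift : Continuous fun x : Plane × ℝ => lift x.1 x.2 := by
  unfold lift; fun_prop

lemma norm_sq_space (p : Space) : ‖p‖ ^ 2 = ‖horiz p‖ ^ 2 + p 2 ^ 2 := by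
  simp [EuclideanSpace.norm_sq_eq, Fin.sum_univ_three]

lemma norm_lift_sq (v : Plane) (z : ℝ) : ‖lift v z‖ ^ 2 = ‖v‖ ^ 2 + z ^ 2 := by
  simp [norm_sq_space]

lemma mem_graph {f : Plane → ℝ} {p : Space} : p ∈ graph f ↔ p 2 = f (horiz p) := Iff.rfl

/-! ### Chord directions and isometries -/

/-- The cone of directions of the chords of a set. -/
def chordCone (S : Set Space) : Set Space :=
  {w | w ≠ 0 ∧ ∃ p ∈ S, ∃ t : ℝ, 0 < t ∧ p + t • w ∈ S}

lemma mem_chordCone_graph {f : Plane → ℝ} {w : Space} :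
    w ∈ chordCone (graph f) ↔
      w ≠ 0 ∧ ∃ q : Plane, ∃ t : ℝ, 0 < t ∧ f (q + t • horiz w) - f q = t * w 2 := by
  refine and_congr_right fun _ => ⟨?_, ?_⟩
  · rintro ⟨p, hp, t, ht, h⟩
    refine ⟨horiz p, t, ht, ?_⟩
    rw [mem_graph] at hp h
    simp only [horiz_add, horiz_smul] at h
    rw [← h, ← hp]; simp
  · rintro ⟨q, t, ht, h⟩
    refine ⟨lift q (f q), by simp [mem_graph], t, ht, ?_⟩
    simp only [mem_graph, horiz_add, horiz_smul, horiz_lift]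
    simp; linarith

lemma directions_eq (f : Plane → ℝ) : directions f = sphere ∩ chordCone (graph f) := by
  ext v
  constructor
  · rintro ⟨p, hp, q, hq, hpq, rfl⟩
    have h0 : ‖p - q‖ ≠ 0 := norm_ne_zero_iff.2 (sub_ne_zero.2 hpq)
    refine ⟨?_, smul_ne_zero (inv_ne_zero h0) (sub_ne_zero.2 hpq), q, hq, ‖p - q‖, by positivity, ?_⟩
    · simp [sphere, norm_smul, h0]
    · rw [smul_inv_smul₀ h0]; simpa using hp
  · rintro ⟨hv, hv0, p, hp, t, ht, h⟩
    have hv1 : ‖v‖ = 1 := by simpa [sphere] using hv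
    refine ⟨_, h, p, hp, by simpa using ⟨ht.ne', hv0⟩, ?_⟩
    simp [norm_smul, hv1, abs_of_pos ht, smul_smul, ht.ne']

lemma chordCone_image (φ : Space ≃ᵢ Space) (S : Set Space) (w : Space) :
    φ.toRealAffineIsometryEquiv.linearIsometryEquiv w ∈ chordCone (φ '' S) ↔
      w ∈ chordCone S := by
  have key (p : Space) (t : ℝ) :
      φ p + t • φ.toRealAffineIsometryEquiv.linearIsometryEquiv w = φ (p + t • w) := by
    have := φ.toRealAffineIsometryEquiv.map_vadd p (t • w)
    simp only [vadd_eq_add, map_smul] at this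
    rw [add_comm p, add_comm (φ p)]
    exact this.symm
  simp only [chordCone, Set.mem_ofPred_eq, ne_eq, EmbeddingLike.map_eq_zero_iff,
    Set.exists_mem_image, key, φ.injective.mem_set_image]

/-! ### The slope epigraph as a closed convex cone -/

/-- The cone over the epigraph of the upper slope of `f`: the points `(v, z)` such that all the
slopes of `f` in the direction `v` are at most `z`. -/
def slopeEpigraph (f : Plane → ℝ) : Set Space :=
  {p | ∀ (q : Plane) (t : ℝ), 0 < t → f (q + t • horiz p) - f q ≤ t * p 2}

section
variable {f : Plane → ℝ}

lemma isClosed_slopeEpigraph (hf : Continuous f) : IsClosed (slopeEpigraph f) := by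
  simp only [slopeEpigraph, Set.ofPred_forall]
  refine isClosed_iInter fun q => isClosed_iInter fun t => isClosed_iInter fun _ => ?_
  have := continuous_horiz
  exact isClosed_le (by fun_prop) (by fun_prop)

/-- Split the increment at the intermediate point x + t • `horiz p`. With positive scaling this
gives convexity. -/
lemma add_mem_slopeEpigraph {p q : Space} (hp : p ∈ slopeEpigraph f) (hq : q ∈ slopeEpigraph f) :
    p + q ∈ slopeEpigraph f := by
  intro x t ht
  have h1 := hp x t ht
  have h2 := hq (x + t • horiz p) t ht
  rw [horiz_add, smul_add, ← add_assoc]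
  simp only [PiLp.add_apply]
  linarith

lemma smul_mem_slopeEpigraph {p : Space} (hp : p ∈ slopeEpigraph f) {r : ℝ} (hr : 0 ≤ r) :
    r • p ∈ slopeEpigraph f := by
  intro x t ht
  rcases hr.eq_or_lt with rfl | hr
  · simp
  · have := hp x (t * r) (by positivity)
    simpa [smul_smul, mul_assoc] using this

lemma smul_mem_slopeEpigraph_iff {p : Space} {r : ℝ} (hr : 0 < r) :
    r • p ∈ slopeEpigraph f ↔ p ∈ slopeEpigraph f := by
  refine ⟨fun h => ?_, fun h => smul_mem_slopeEpigraph h hr.le⟩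
  have := smul_mem_slopeEpigraph h (inv_nonneg.2 hr.le)
  rwa [inv_smul_smul₀ hr.ne'] at this

lemma lift_zero_mem_slopeEpigraph {z : ℝ} (hz : 0 ≤ z) : lift 0 z ∈ slopeEpigraph f := by
  intro x t ht
  simpa using by positivity

lemma neg_mem_slopeEpigraph {p : Space} : -p ∈ slopeEpigraph f ↔
    ∀ (q : Plane) (t : ℝ), 0 < t → t * p 2 ≤ f (q + t • horiz p) - f q := by
  constructor
  · intro h q t ht
    have := h (q + t • horiz p) t ht
    simp at this
    linarith
  · intro h q t ht
    have := h (q - t • horiz p) t ht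
    simp only [sub_add_cancel] at this
    simp [← sub_eq_add_neg]
    linarith

lemma slopeEpigraph_const_mul {c : ℝ} (hc : 0 < c) (p : Space) :
    p ∈ slopeEpigraph (fun x => c * f x) ↔ lift (horiz p) (p 2 / c) ∈ slopeEpigraph f := by
  refine forall₃_congr fun q t ht => ?_
  simp only [horiz_lift, lift_two_coord]
  rw [← mul_sub, ← mul_div_assoc, le_div_iff₀' hc]

/-- If both alternatives failed, one chord over `horiz w` would be too steep and another not steep
enough. Base points and positive lengths form a connected set, so some chord would have exactly the
slope of w. -/
lemma mem_chordCone_or (hf : Continuous f) {w : Space} (hw : w ∉ chordCone (graph f)) :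
    w ∈ slopeEpigraph f ∨ -w ∈ slopeEpigraph f := by
  by_cases h0 : w = 0
  · left; subst h0; intro q t ht; simp
  rw [mem_chordCone_graph] at hw
  push Not at hw
  rw [neg_mem_slopeEpigraph]
  by_contra! hcon
  obtain ⟨h1, q₂, t₂, ht₂, h2⟩ := hcon
  simp only [slopeEpigraph, Set.mem_ofPred_eq] at h1
  push Not at h1
  obtain ⟨q₁, t₁, ht₁, h1⟩ := h1
  have hconn : IsPreconnected ((Set.univ : Set Plane) ×ˢ Set.Ioi (0 : ℝ)) :=
    isPreconnected_univ.prod isPreconnected_Ioi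
  obtain ⟨⟨q, t⟩, ⟨-, ht⟩, h⟩ := hconn.intermediate_value₂ (a := (q₂, t₂)) (b := (q₁, t₁))
    (f := fun x => f (x.1 + x.2 • horiz w) - f x.1) (g := fun x => x.2 * w 2)
    ⟨trivial, ht₂⟩ ⟨trivial, ht₁⟩ (by fun_prop) (by fun_prop) h2.le h1.le
  exact hw h0 q t ht h

/-- A boundary point of the epigraph may still be a chord direction. An arbitrarily small vertical
shift makes the slope inequality strict, hence the closure. -/
lemma closure_compl_chordCone (hf : Continuous f) :
    closure (chordCone (graph f))ᶜ = slopeEpigraph f ∪ -slopeEpigraph f := by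
  apply subset_antisymm
  · exact closure_minimal (fun w hw => mem_chordCone_or hf hw)
      ((isClosed_slopeEpigraph hf).union (isClosed_slopeEpigraph hf).neg)
  · have lim (w : Space) (s : ℝ) (h : ∀ ε > 0, w + lift 0 (s * ε) ∈ (chordCone (graph f))ᶜ) :
        w ∈ closure (chordCone (graph f))ᶜ := by
      have hc : Continuous fun ε : ℝ => w + lift 0 (s * ε) :=
        continuous_const.add (continuous_lift.comp (by fun_prop : Continuous fun ε : ℝ =>
          ((0 : Plane), s * ε)))
      have ht : Filter.Tendsto (fun ε : ℝ => w + lift 0 (s * ε)) (nhdsWithin 0 (Set.Ioi 0))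
          (nhds w) := by
        have := hc.tendsto 0
        rw [mul_zero, lift_eq_zero.2 ⟨rfl, rfl⟩, add_zero] at this
        exact this.mono_left nhdsWithin_le_nhds
      exact mem_closure_of_tendsto ht (Filter.eventually_of_mem self_mem_nhdsWithin h)
    rintro w (hw | hw)
    · refine lim w 1 fun ε hε => ?_
      simp only [Set.mem_compl_iff, mem_chordCone_graph]
      rintro ⟨-, q, t, ht, h⟩
      have := hw q t ht
      simp at h
      nlinarith [mul_pos ht hε]
    · refine lim w (-1) fun ε hε => ?_
      simp only [Set.mem_compl_iff, mem_chordCone_graph]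
      rintro ⟨-, q, t, ht, h⟩
      have := neg_mem_slopeEpigraph.1 hw q t ht
      simp at h
      nlinarith [mul_pos ht hε]

/-! ### A line in the slope epigraph gives case (A) -/

lemma northPole_mem_sphere : northPole ∈ sphere := by
  have := norm_lift_sq 0 1
  rw [← northPole_eq] at this
  simp [sphere]
  have h := norm_nonneg northPole
  simp at this
  rcases this with h | h <;> linarith

lemma isVerticalGreatCircle_span {v : Plane} (hv : v ≠ 0) : IsVerticalGreatCircle
    ((Submodule.span ℝ {lift v 0, northPole} : Set Space) ∩ sphere) := by
  have hn : northPole ∈ Submodule.span ℝ {lift v 0, northPole} :=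
    Submodule.subset_span (by simp)
  refine ⟨⟨_, ?_, rfl⟩, ⟨hn, northPole_mem_sphere⟩, Submodule.neg_mem _ hn, ?_⟩
  · have : LinearIndependent ℝ ![lift v 0, northPole] := by
      rw [LinearIndependent.pair_iff]
      intro s t h
      rw [northPole_eq, smul_lift, smul_lift, lift_add, lift_eq_zero] at h
      simpa [hv] using h
    have h2 := finrank_span_eq_card this
    rwa [Matrix.range_cons_cons_empty, Fintype.card_fin] at h2
  · simpa [sphere] using northPole_mem_sphere

/-- The two memberships bound the slopes from both sides, so all increments along `horiz w` are
those of w. The vertical circle through w then meets `directions f` only in the two unit multiples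
of w. -/
lemma caseA_of_mem_of_neg_mem {w : Space} (hw0 : w ≠ 0) (hw : w ∈ slopeEpigraph f)
    (hw' : -w ∈ slopeEpigraph f) : CaseA f := by
  have heq : ∀ (q : Plane) (t : ℝ), 0 < t → f (q + t • horiz w) - f q = t * w 2 := fun q t ht =>
    le_antisymm (hw q t ht) (neg_mem_slopeEpigraph.1 hw' q t ht)
  have hv : horiz w ≠ 0 := by
    intro h
    have := heq 0 1 one_pos
    simp only [h, smul_zero, add_zero, sub_self, one_mul] at this
    apply hw0
    rw [← lift_horiz w, h, ← this, lift_eq_zero]; simp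
  refine ⟨_, isVerticalGreatCircle_span hv, ?_⟩
  have hnw : ‖w‖ ≠ 0 := norm_ne_zero_iff.2 hw0
  have heq' : ∀ (q : Plane) (t : ℝ), f (q + t • horiz w) - f q = t * w 2 := by
    intro q t
    rcases lt_trichotomy t 0 with ht | rfl | ht
    · have := heq (q + t • horiz w) (-t) (by linarith)
      simp at this
      linarith
    · simp
    · exact heq q t ht
  have hmul : ∀ r : ℝ, |r| = ‖w‖⁻¹ → r • w ∈
      (Submodule.span ℝ {lift (horiz w) 0, northPole} : Set Space) ∩ sphere ∩ directions f := by
    intro r hr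
    have hr0 : r ≠ 0 := by
      rintro rfl
      simp at hr
      exact hw0 (norm_eq_zero.1 hr.symm)
    have hs : r • w ∈ sphere := by simp [sphere, norm_smul, hr, hnw]
    refine ⟨⟨?_, hs⟩, ?_⟩
    · apply Submodule.smul_mem
      rw [Submodule.mem_span_pair]
      refine ⟨1, w 2, ?_⟩
      rw [northPole_eq, smul_lift, smul_lift, lift_add]
      simp
    · rw [directions_eq]
      refine ⟨hs, mem_chordCone_graph.2 ⟨smul_ne_zero hr0 hw0, 0, 1, one_pos, ?_⟩⟩
      have := heq' 0 r
      simpa using this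
  have hset : (Submodule.span ℝ {lift (horiz w) 0, northPole} : Set Space) ∩ sphere ∩ directions f
      = {‖w‖⁻¹ • w, (-‖w‖⁻¹) • w} := by
    apply subset_antisymm
    · rintro p ⟨⟨hp, hps⟩, hpd⟩
      rw [SetLike.mem_coe, Submodule.mem_span_pair] at hp
      obtain ⟨a, b, rfl⟩ := hp
      rw [directions_eq] at hpd
      obtain ⟨-, hpd⟩ := hpd
      rw [mem_chordCone_graph] at hpd
      obtain ⟨-, q, t, ht, h⟩ := hpd
      rw [northPole_eq, smul_lift, smul_lift, lift_add] at h hps ⊢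
      simp [smul_smul, heq'] at h
      have hb : b = a * w 2 := by
        have : t * (a * w 2 - b) = 0 := by linarith
        rcases mul_eq_zero.1 this with h | h
        · exact absurd h ht.ne'
        · linarith
      have hw2 : lift (a • horiz w + b • 0) (a * 0 + b * 1) = a • w := by
        rw [hb]
        exact space_ext (by simp) (by simp) (by simp)
      rw [hw2] at hps ⊢
      have ha : |a| * ‖w‖ = 1 := by simpa [sphere, norm_smul] using hps
      have ha' : |a| = ‖w‖⁻¹ := eq_inv_of_mul_eq_one_left ha
      rcases abs_choice a with h | h
      · left; rw [← ha', h]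
      · right
        rw [Set.mem_singleton_iff, ← ha', h, neg_neg]
    · rintro p (rfl | rfl)
      · exact hmul _ (by simp)
      · exact hmul _ (by simp)
  rw [hset, Set.ncard_pair]
  intro h
  have := smul_left_injective ℝ hw0 h
  have h2 : 0 < ‖w‖⁻¹ := by positivity
  linarith

end

/-! ### Pointed epigraphs and their congruences -/

/-- A set is pointed if it contains no line through the origin: of any two opposite nonzero
points at most one belongs to it. -/
def IsPointed (E : Set Space) : Prop := ∀ p, p ∈ E → -p ∈ E → p = 0

section
variable {f : Plane → ℝ}

lemma isPointed_slopeEpigraph (hA : ¬ CaseA f) : IsPointed (slopeEpigraph f) := by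
  intro p hp hp'
  by_contra h0
  exact hA (caseA_of_mem_of_neg_mem h0 hp hp')

lemma IsPointed.const_mul (hP : IsPointed (slopeEpigraph f)) {c : ℝ} (hc : 0 < c) :
    IsPointed (slopeEpigraph fun x => c * f x) := by
  intro p hp hp'
  rw [slopeEpigraph_const_mul hc] at hp hp'
  have := hP _ hp (by
    rw [neg_lift]
    simpa [neg_div] using hp')
  rw [lift_eq_zero] at this
  obtain ⟨h1, h2⟩ := this
  rw [← lift_horiz p, lift_eq_zero]
  exact ⟨h1, by simpa [hc.ne'] using h2⟩

/-- Removing the apex of a pointed convex cone leaves a convex set: a segment through 0 would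
produce opposite points. -/
lemma isPreconnected_slopeEpigraph_diff (hP : IsPointed (slopeEpigraph f)) :
    IsPreconnected (slopeEpigraph f \ {0}) := by
  refine Convex.isPreconnected ?_
  rintro p ⟨hp, hp0⟩ q ⟨hq, hq0⟩ a b ha hb hab
  refine ⟨add_mem_slopeEpigraph (smul_mem_slopeEpigraph hp ha) (smul_mem_slopeEpigraph hq hb), ?_⟩
  intro h
  have h1 : a • p = -(b • q) := eq_neg_of_add_eq_zero_left h
  have h2 := hP (a • p) (smul_mem_slopeEpigraph hp ha)
    (by rw [h1, neg_neg]; exact smul_mem_slopeEpigraph hq hb)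
  rw [h2] at h1
  have h3 : b • q = 0 := neg_eq_zero.1 h1.symm
  simp only [Set.mem_singleton_iff] at hp0 hq0
  have ha0 : a = 0 := by simpa [hp0] using h2
  have hb0 : b = 0 := by simpa [hq0] using h3
  linarith

/-- A linear isometry that maps `E ∪ -E` onto `E' ∪ -E'`, where `E` and `E'` are the slope
epigraphs, maps `E` into one of the two halves. -/
lemma map_slopeEpigraph_subset {g : Plane → ℝ} (hg : Continuous g)
    (hPf : IsPointed (slopeEpigraph f)) (hPg : IsPointed (slopeEpigraph g)) (O : Space ≃ₗᵢ[ℝ] Space)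
    (h : ∀ p, p ∈ slopeEpigraph f ∪ -slopeEpigraph f →
      O p ∈ slopeEpigraph g ∪ -slopeEpigraph g) :
    (∀ p ∈ slopeEpigraph f, O p ∈ slopeEpigraph g) ∨
      ∀ p ∈ slopeEpigraph f, O p ∈ -slopeEpigraph g := by
  have hz : (0 : Space) ∈ slopeEpigraph g := by
    simpa using smul_mem_slopeEpigraph (lift_zero_mem_slopeEpigraph (f := g) le_rfl) le_rfl
  -- The connected image is covered by two closed sets that meet only at 0, and it avoids 0.
  have hconn := (isPreconnected_slopeEpigraph_diff hPf).image O O.continuous.continuousOn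
  rw [isPreconnected_iff_subset_of_disjoint_closed] at hconn
  have hcl := isClosed_slopeEpigraph hg
  rcases hconn _ _ hcl hcl.neg (by
      rintro _ ⟨p, ⟨hp, -⟩, rfl⟩
      exact h p (Or.inl hp)) (by
      rw [Set.eq_empty_iff_forall_notMem]
      rintro _ ⟨⟨p, ⟨hp, hp0⟩, rfl⟩, h1, h2⟩
      have := hPg _ h1 h2
      simp only [EmbeddingLike.map_eq_zero_iff] at this
      exact hp0 this) with h1 | h1
  · left
    intro p hp
    by_cases hp0 : p = 0
    · simpa [hp0] using hz
    · exact h1 ⟨p, ⟨hp, hp0⟩, rfl⟩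
  · right
    intro p hp
    by_cases hp0 : p = 0
    · simpa [hp0] using hz
    · exact h1 ⟨p, ⟨hp, hp0⟩, rfl⟩

lemma exists_linearIsometryEquiv_of_image_graph {g : Plane → ℝ} (hf : Continuous f)
    (hg : Continuous g) (hPf : IsPointed (slopeEpigraph f)) (hPg : IsPointed (slopeEpigraph g))
    (φ : Space ≃ᵢ Space) (hφ : φ '' graph f = graph g) :
    ∃ O : Space ≃ₗᵢ[ℝ] Space, ∀ p, O p ∈ slopeEpigraph g ↔ p ∈ slopeEpigraph f := by
  set O := φ.toRealAffineIsometryEquiv.linearIsometryEquiv with hO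
  have hcone : ∀ p, O p ∈ slopeEpigraph g ∪ -slopeEpigraph g ↔
      p ∈ slopeEpigraph f ∪ -slopeEpigraph f := by
    have h1 : O ⁻¹' (chordCone (graph g))ᶜ = (chordCone (graph f))ᶜ := by
      ext p
      have := chordCone_image φ (graph f) p
      rw [hφ] at this
      exact not_congr this
    intro p
    rw [← closure_compl_chordCone hf, ← closure_compl_chordCone hg, ← h1]
    have h2 := O.toHomeomorph.preimage_closure (chordCone (graph g))ᶜ
    exact Set.ext_iff.1 h2 p
  have hback : ∀ p, p ∈ slopeEpigraph g ∪ -slopeEpigraph g →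
      O.symm p ∈ slopeEpigraph f ∪ -slopeEpigraph f := by
    intro p hp
    rw [← hcone]; simpa using hp
  have hz : lift 0 1 ≠ 0 := by rw [ne_eq, lift_eq_zero]; simp
  have hf1 := lift_zero_mem_slopeEpigraph (f := f) zero_le_one
  -- Mixed signs for O and its inverse would put the downward vertical in the epigraph of f. If both
  -- signs are negative, -O is the required map.
  rcases map_slopeEpigraph_subset hg hPf hPg O (fun p hp => (hcone p).2 hp) with h1 | h1 <;>
  rcases map_slopeEpigraph_subset hf hPg hPf O.symm hback with h2 | h2
  · exact ⟨O, fun p => ⟨fun h => by simpa using h2 _ h, h1 p⟩⟩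
  · exact absurd (hPf _ hf1 (by simpa using h2 _ (h1 _ hf1))) hz
  · have h3 := h2 (-O (lift 0 1)) (h1 _ hf1)
    exact absurd (hPf _ hf1 (by simpa using h3)) hz
  · refine ⟨O.trans (LinearIsometryEquiv.neg ℝ), fun p => ⟨fun h => ?_, fun h => ?_⟩⟩
    · have h3 := h2 _ h
      simpa using h3
    · simpa using h1 p h

/-! ### Recurrence and the limit of large factors -/

/-- A distance-preserving map that fixes the origin and maps a set `E` into a closed subset `F` of
`E` forces `E ⊆ F`, by recurrence. -/
lemma subset_of_isometry_mapsTo {E F : Set Space} (hF : IsClosed F) (hFE : F ⊆ E)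
    {A : Space → Space} (hA : Isometry A) (hA0 : A 0 = 0) (hEF : ∀ p ∈ E, A p ∈ F) : E ⊆ F := by
  intro e he
  have hAi : ∀ n : ℕ, Isometry A^[n] := fun n => by
    induction n with
    | zero => exact isometry_id
    | succ n ih => rw [Function.iterate_succ]; exact ih.comp hA
  have hAF : ∀ n : ℕ, A^[n + 1] e ∈ F := fun n => by
    induction n with
    | zero => exact hEF e he
    | succ n ih => rw [Function.iterate_succ_apply']; exact hEF _ (hFE ih)
  have hbdd : ∀ n : ℕ, A^[n] e ∈ Metric.closedBall (0 : Space) ‖e‖ := fun n => by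
    have h0 : A^[n] 0 = 0 := Function.iterate_fixed hA0 n
    have := (hAi n).dist_eq e 0
    rw [h0, dist_zero_right e] at this
    exact this.le
  obtain ⟨x, -, φ, hφ, hx⟩ := (isCompact_closedBall (0 : Space) ‖e‖).tendsto_subseq hbdd
  rw [← hF.closure_eq, Metric.mem_closure_iff]
  intro ε hε
  obtain ⟨N, hN⟩ := Metric.cauchySeq_iff.1 hx.cauchySeq ε hε
  have h1 := hN N le_rfl (N + 1) (Nat.le_succ N)
  have h2 : φ N < φ (N + 1) := hφ (Nat.lt_succ_self N)
  -- Cancelling the first `φ N` iterates leaves e close to iterate d + 1 of e; being a positive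
  -- iterate, it lies in F.
  obtain ⟨d, hd⟩ := Nat.exists_eq_add_of_lt h2
  refine ⟨A^[d + 1] e, hAF d, ?_⟩
  simp only [Function.comp_apply] at h1
  rwa [hd, add_assoc, Function.iterate_add_apply, (hAi _).dist_eq] at h1

/-- Pointwise limits of linear isometries along an ultrafilter exist. -/
lemma exists_tendsto_linearIsometryEquiv (l : Ultrafilter ℕ) (O : ℕ → Space ≃ₗᵢ[ℝ] Space) :
    ∃ A : Space → Space, Isometry A ∧ A 0 = 0 ∧
      ∀ p, Filter.Tendsto (fun n => O n p) l (nhds (A p)) := by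
  have h : ∀ p : Space, ∃ y, Filter.Tendsto (fun n => O n p) l (nhds y) := by
    intro p
    obtain ⟨y, -, hy⟩ := (isCompact_closedBall (0 : Space) ‖p‖).ultrafilter_le_nhds'
      (l.map fun n => O n p) (by
        rw [Ultrafilter.mem_map]
        exact Filter.univ_mem' fun n => by simp)
    exact ⟨y, hy⟩
  choose A hA using h
  refine ⟨A, Isometry.of_dist_eq fun p q => ?_, ?_, hA⟩
  · refine tendsto_nhds_unique ((hA p).dist (hA q)) ?_
    simp only [LinearIsometryEquiv.dist_map]
    exact tendsto_const_nhds
  · refine tendsto_nhds_unique (hA 0) ?_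
    simp only [map_zero]
    exact tendsto_const_nhds

/-- The slope epigraphs of suitable multiples of `f` are congruent to that of `f`, and the factors
tend to infinity. -/
structure CongruentMultiples (f : Plane → ℝ) (c : ℕ → ℝ) (O : ℕ → Space ≃ₗᵢ[ℝ] Space) : Prop where
  pos : ∀ n, 0 < c n
  tendsto : Filter.Tendsto c Filter.atTop Filter.atTop
  mem_iff : ∀ n p, lift (horiz (O n p)) ((O n p) 2 / c n) ∈ slopeEpigraph f ↔ p ∈ slopeEpigraph f

lemma exists_congruentMultiples {C : Set ℝ} (hC : CondensatesToInfty C) (hf : Continuous f)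
    (hP : IsPointed (slopeEpigraph f)) (hrigid : VerticallyRigidFor f C) :
    ∃ c O, CongruentMultiples f c O := by
  have h : ∀ n : ℕ, ∃ c ∈ C, (n : ℝ) < c := by
    intro n
    by_contra! hcon
    apply hC.2 n
    have : C ∩ Set.Ioi (n : ℝ) = ∅ := by
      ext x
      simp only [Set.mem_inter_iff, Set.mem_Ioi, Set.mem_empty_iff_false, iff_false, not_and, not_lt]
      exact hcon x
    rw [this]; exact Set.countable_empty
  choose c hcC hc using h
  have hpos : ∀ n, 0 < c n := fun n => hC.1 (hcC n)
  have hO : ∀ n, ∃ O : Space ≃ₗᵢ[ℝ] Space, ∀ p,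
      O p ∈ slopeEpigraph (fun x => c n * f x) ↔ p ∈ slopeEpigraph f := by
    intro n
    obtain ⟨φ, hφ⟩ := hrigid (c n) (hcC n)
    exact exists_linearIsometryEquiv_of_image_graph hf (by fun_prop) hP (hP.const_mul (hpos n)) φ hφ
  choose O hO using hO
  refine ⟨c, O, hpos, ?_, fun n p => ?_⟩
  · exact Filter.tendsto_atTop_mono (fun n => (hc n).le) tendsto_natCast_atTop_atTop
  · rw [← slopeEpigraph_const_mul (hpos n), hO]

/-- If p had height -z < 0, the stretched epigraphs would contain both the vertical vector of height
z and (`horiz p` / c, -z), which are opposite in the limit. Pulled back, they would subconverge to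
nonzero x and -x in the epigraph, against pointedness. -/
lemma CongruentMultiples.nonneg {c : ℕ → ℝ} {O : ℕ → Space ≃ₗᵢ[ℝ] Space}
    (h : CongruentMultiples f c O) (hf : Continuous f) (hP : IsPointed (slopeEpigraph f))
    {p : Space} (hp : p ∈ slopeEpigraph f) : 0 ≤ p 2 := by
  by_contra! hneg
  have hmem : ∀ n (q : Space), lift (horiz q) (q 2 / c n) ∈ slopeEpigraph f →
      (O n).symm q ∈ slopeEpigraph f := by
    intro n q hq
    rw [← h.mem_iff n]
    simpa using hq
  set z := -p 2 with hz
  have hz0 : 0 < z := by linarith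
  have he : ∀ n, (O n).symm (lift ((c n)⁻¹ • horiz p) (-z)) ∈ slopeEpigraph f := by
    intro n
    apply hmem
    rw [← smul_mem_slopeEpigraph_iff (h.pos n), smul_lift]
    have := (h.pos n).ne'
    simp only [horiz_lift, smul_smul, lift_two_coord, mul_inv_cancel₀ this, one_smul, hz, neg_neg,
      mul_div_cancel₀ _ this, lift_horiz]
    exact hp
  have he' : ∀ n, (O n).symm (lift 0 z) ∈ slopeEpigraph f := by
    intro n
    apply hmem
    simp only [horiz_lift, lift_two_coord]
    exact lift_zero_mem_slopeEpigraph (div_pos hz0 (h.pos n)).le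
  obtain ⟨x, -, φ, hφ, hx⟩ := (isCompact_closedBall (0 : Space) ‖lift 0 z‖).tendsto_subseq
    (x := fun n => (O n).symm (lift 0 z)) (by simp)
  have hxE : x ∈ slopeEpigraph f :=
    (isClosed_slopeEpigraph hf).mem_of_tendsto hx (Filter.univ_mem' fun n => he' (φ n))
  have hsum : Filter.Tendsto (fun n => (O n).symm (lift ((c n)⁻¹ • horiz p) 0)) Filter.atTop
      (nhds 0) := by
    rw [tendsto_zero_iff_norm_tendsto_zero]
    simp only [LinearIsometryEquiv.norm_map]
    have h1 := (h.tendsto.inv_tendsto_atTop).smul_const (horiz p)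
    have h2 := ((continuous_lift.tendsto ((0 : ℝ) • horiz p, (0 : ℝ))).comp
      (h1.prodMk_nhds tendsto_const_nhds)).norm
    simpa [lift_eq_zero.2] using h2
  -- The two vectors add up to a horizontal vector that tends to 0.
  have hx' : Filter.Tendsto (fun n => (O (φ n)).symm (lift ((c (φ n))⁻¹ • horiz p) (-z)))
      Filter.atTop (nhds (0 - x)) := by
    refine ((hsum.comp hφ.tendsto_atTop).sub hx).congr fun n => ?_
    simp only [Function.comp_apply, ← map_sub]
    congr 1
    exact space_ext (by simp) (by simp) (by simp)
  have hxE' : -x ∈ slopeEpigraph f := by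
    rw [← zero_sub]
    exact (isClosed_slopeEpigraph hf).mem_of_tendsto hx' (Filter.univ_mem' fun n => he (φ n))
  have hx0 : ‖x‖ = ‖lift 0 z‖ := by
    refine tendsto_nhds_unique hx.norm ?_
    simp only [Function.comp_apply, LinearIsometryEquiv.norm_map]
    exact tendsto_const_nhds
  rw [hP x hxE hxE', norm_zero, eq_comm, norm_eq_zero, lift_eq_zero] at hx0
  exact hz0.ne' hx0.2

/-- Undoing the stretch divides the bounded heights of `O n q` by c n → ∞. In the limit the
horizontal part of A q is in the epigraph, so A maps the epigraph into F and recurrence applies. -/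
lemma CongruentMultiples.lift_horiz_mem {c : ℕ → ℝ} {O : ℕ → Space ≃ₗᵢ[ℝ] Space}
    (h : CongruentMultiples f c O) (hf : Continuous f) (hP : IsPointed (slopeEpigraph f))
    {p : Space} (hp : p ∈ slopeEpigraph f) : lift (horiz p) 0 ∈ slopeEpigraph f := by
  have hcl := isClosed_slopeEpigraph hf
  obtain ⟨A, hA, hA0, hlim⟩ := exists_tendsto_linearIsometryEquiv (Filter.hyperfilter ℕ) O
  have hle : (Filter.hyperfilter ℕ : Filter ℕ) ≤ Filter.atTop := Nat.hyperfilter_le_atTop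
  have hc := h.tendsto.mono_left hle
  have hlc : Continuous fun p : Space => lift (horiz p) 0 :=
    continuous_lift.comp (continuous_horiz.prodMk continuous_const)
  set F : Set Space := {p | 0 ≤ p 2} ∩ {p | lift (horiz p) 0 ∈ slopeEpigraph f} with hFdef
  have hF : IsClosed F :=
    (isClosed_le continuous_const (continuous_coord 2)).inter (hcl.preimage hlc)
  have hFE : F ⊆ slopeEpigraph f := by
    rintro q ⟨hq, hq'⟩
    have := add_mem_slopeEpigraph hq' (lift_zero_mem_slopeEpigraph hq)
    rw [lift_add] at this
    simpa using this
  have hEF : ∀ p ∈ slopeEpigraph f, A p ∈ F := by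
    intro q hq
    have hq1 : Filter.Tendsto (fun n => (O n q) 2 / c n) (Filter.hyperfilter ℕ) (nhds 0) :=
      (((continuous_coord 2).tendsto _).comp (hlim q)).div_atTop hc
    have hmem := fun n => (h.mem_iff n q).2 hq
    constructor
    · refine ge_of_tendsto (((continuous_coord 2).tendsto _).comp (hlim q))
        (Filter.univ_mem' fun n => ?_)
      have := h.nonneg hf hP (hmem n)
      rw [lift_two_coord, le_div_iff₀ (h.pos n), zero_mul] at this
      exact this
    · have ht := (continuous_lift.tendsto (horiz (A q), (0 : ℝ))).comp
        (((continuous_horiz.tendsto _).comp (hlim q)).prodMk_nhds hq1)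
      exact hcl.mem_of_tendsto ht (Filter.univ_mem' hmem)
  exact (subset_of_isometry_mapsTo hF hFE hA hA0 hEF hp).2

end

/-! ### Planar cones and arcs -/

/-- The point of the unit circle with angle `t`. -/
noncomputable def polar (t : ℝ) : Plane := !₂[Real.cos t, Real.sin t]

@[simp] lemma polar_zero_coord (t : ℝ) : polar t 0 = Real.cos t := by simp [polar]
@[simp] lemma polar_one_coord (t : ℝ) : polar t 1 = Real.sin t := by simp [polar]

lemma polar_mem_circle (t : ℝ) : polar t ∈ circle := by
  simp [circle, EuclideanSpace.norm_eq, Fin.sum_univ_two]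

lemma continuous_polar : Continuous polar := by unfold polar; fun_prop

lemma polar_add_pi (t : ℝ) : polar (t + Real.pi) = -polar t :=
  plane_ext (by simp) (by simp)

/-- Rotate x by -t₀ and take s to be the complex argument of the result. -/
lemma exists_polar_eq {x : Plane} (hx : x ∈ circle) (t₀ : ℝ) :
    ∃ s ∈ Set.Icc (-Real.pi) Real.pi, polar (t₀ + s) = x := by
  have hx1 : x 0 ^ 2 + x 1 ^ 2 = 1 := by
    have : ‖x‖ = 1 := by simpa [circle] using hx
    have h2 := EuclideanSpace.norm_sq_eq x
    rw [this] at h2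
    simpa [Fin.sum_univ_two] using h2.symm
  set u := x 0 * Real.cos t₀ + x 1 * Real.sin t₀ with hu
  set v := x 1 * Real.cos t₀ - x 0 * Real.sin t₀ with hv
  have hcs := Real.sin_sq_add_cos_sq t₀
  have huv : u ^ 2 + v ^ 2 = 1 := by
    have : u ^ 2 + v ^ 2 = (x 0 ^ 2 + x 1 ^ 2) * (Real.sin t₀ ^ 2 + Real.cos t₀ ^ 2) := by
      rw [hu, hv]; ring
    rw [this, hx1, hcs, one_mul]
  set z : ℂ := ⟨u, v⟩ with hz
  have hnz : ‖z‖ = 1 := by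
    rw [← sq_eq_sq₀ (norm_nonneg _) zero_le_one, Complex.sq_norm, Complex.normSq_apply]
    simp only [hz]; linarith
  have hz0 : z ≠ 0 := by rw [← norm_ne_zero_iff, hnz]; exact one_ne_zero
  refine ⟨z.arg, ⟨(Complex.neg_pi_lt_arg z).le, Complex.arg_le_pi z⟩, ?_⟩
  have hc : Real.cos z.arg = u := by rw [Complex.cos_arg hz0, hnz]; simp [hz]
  have hs : Real.sin z.arg = v := by rw [Complex.sin_arg, hnz]; simp [hz]
  apply plane_ext
  · rw [polar_zero_coord, Real.cos_add, hc, hs, hu, hv]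
    linear_combination (x 0) * hcs
  · rw [polar_one_coord, Real.sin_add, hc, hs, hu, hv]
    linear_combination (x 1) * hcs

/-- A nonempty intersection of the unit circle with a closed pointed convex cone is an arc shorter
than `π`. -/
lemma exists_circleArc_eq {P : Set Plane} (hP : IsClosed P)
    (hadd : ∀ x ∈ P, ∀ y ∈ P, x + y ∈ P) (hsmul : ∀ x ∈ P, ∀ r : ℝ, 0 ≤ r → r • x ∈ P)
    (hneg : ∀ x ∈ P, x ∈ circle → -x ∉ P) (hne : (P ∩ circle).Nonempty) :
    ∃ a b : ℝ, 0 ≤ b - a ∧ b - a < Real.pi ∧ P ∩ circle = circleArc a b := by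
  obtain ⟨x₀, hx₀, hx₀c⟩ := hne
  obtain ⟨t₀, -, ht₀⟩ := exists_polar_eq hx₀c 0
  rw [zero_add] at ht₀
  have hpi := Real.pi_pos
  have hnegp : ∀ t, polar t ∈ P → polar (t + Real.pi) ∉ P := by
    intro t ht
    rw [polar_add_pi]
    exact hneg _ ht (polar_mem_circle t)
  -- Uses sin(w - u) polar v = sin(w - v) polar u + sin(v - u) polar w, with nonnegative
  -- coefficients.
  have hbetween : ∀ u v w : ℝ, u ≤ v → v ≤ w → w - u < Real.pi → polar u ∈ P → polar w ∈ P →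
      polar v ∈ P := by
    intro u v w huv hvw hwu hu hw
    rcases (huv.trans hvw).eq_or_lt with h | h
    · rwa [← le_antisymm huv (h ▸ hvw)]
    have hs : 0 < Real.sin (w - u) := Real.sin_pos_of_pos_of_lt_pi (by linarith) hwu
    have h1 : 0 ≤ Real.sin (w - v) :=
      Real.sin_nonneg_of_nonneg_of_le_pi (by linarith) (by linarith)
    have h2 : 0 ≤ Real.sin (v - u) :=
      Real.sin_nonneg_of_nonneg_of_le_pi (by linarith) (by linarith)
    have hmem := hsmul _ (hadd _ (hsmul _ hu _ h1) _ (hsmul _ hw _ h2)) _ (inv_nonneg.2 hs.le)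
    convert hmem using 1
    rw [eq_inv_smul_iff₀ hs.ne']
    apply plane_ext
    · simp [Real.sin_sub]
      ring
    · simp [Real.sin_sub]
      ring
  set Θ : Set ℝ := {s | polar (t₀ + s) ∈ P} ∩ Set.Icc (-Real.pi) Real.pi with hΘ
  have hΘc : IsCompact Θ := isCompact_Icc.inter_left
    (hP.preimage (continuous_polar.comp (continuous_const.add continuous_id)))
  have h0 : (0 : ℝ) ∈ Θ := ⟨by simpa [ht₀] using hx₀, by linarith, hpi.le⟩
  obtain ⟨a, haΘ, ha⟩ := hΘc.exists_isLeast ⟨0, h0⟩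
  obtain ⟨b, hbΘ, hb⟩ := hΘc.exists_isGreatest ⟨0, h0⟩
  have hp0 : polar t₀ ∈ P := by rwa [ht₀]
  have ha0 : a ≤ 0 := ha h0
  have hb0 : 0 ≤ b := hb h0
  have hbpi : b < Real.pi := lt_of_le_of_ne hbΘ.2.2 fun h => hnegp _ hp0 (h ▸ hbΘ.1)
  have hapi : -Real.pi < a := by
    refine lt_of_le_of_ne haΘ.2.1 fun h => hnegp _ haΘ.1 ?_
    rwa [← h, neg_add_cancel_right]
  have hmemIcc : ∀ s ∈ Set.Icc a b, polar (t₀ + s) ∈ P := by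
    rintro s ⟨h1, h2⟩
    rcases le_total s 0 with h | h
    · exact hbetween (t₀ + a) _ t₀ (by linarith) (by linarith) (by linarith) haΘ.1 hp0
    · exact hbetween t₀ _ (t₀ + b) (by linarith) (by linarith) (by linarith) hp0 hbΘ.1
  -- Otherwise a + π would lie in [a, b], putting antipodal points in P.
  have hlen : b - a < Real.pi := by
    by_contra! h
    refine hnegp _ haΘ.1 ?_
    rw [add_assoc]
    exact hmemIcc _ ⟨by linarith, by linarith⟩
  refine ⟨t₀ + a, t₀ + b, by linarith, by linarith, ?_⟩
  apply subset_antisymm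
  · rintro x ⟨hx, hxc⟩
    obtain ⟨s, hs, rfl⟩ := exists_polar_eq hxc t₀
    have hsΘ : s ∈ Θ := ⟨hx, hs⟩
    exact ⟨t₀ + s, ⟨by linarith [ha hsΘ], by linarith [hb hsΘ]⟩, rfl⟩
  · rintro _ ⟨t, ⟨h1, h2⟩, rfl⟩
    have := hmemIcc (t - t₀) ⟨by linarith, by linarith⟩
    rw [add_sub_cancel] at this
    exact ⟨this, polar_mem_circle t⟩

/-! ### Reading off cases (B), (C), (D) -/

section
variable {f : Plane → ℝ}

/-- The slope epigraph of `f` is the product of a horizontal cone and the upper half-line. -/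
structure IsUpperProduct (f : Plane → ℝ) : Prop where
  nonneg : ∀ p ∈ slopeEpigraph f, 0 ≤ p 2
  lift_horiz_mem : ∀ p ∈ slopeEpigraph f, lift (horiz p) 0 ∈ slopeEpigraph f

/-- The directions in which no slope of `f` is positive. -/
def flatDirections (f : Plane → ℝ) : Set Plane := {x | lift x 0 ∈ slopeEpigraph f} ∩ circle

lemma mem_directions_of_notMem (hf : Continuous f) {p : Space} (hp : p ∈ sphere)
    (h : p ∉ slopeEpigraph f) (h' : -p ∉ slopeEpigraph f) : p ∈ directions f := by
  rw [directions_eq]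
  refine ⟨hp, ?_⟩
  by_contra hcon
  exact (mem_chordCone_or hf hcon).elim h h'

lemma neg_mem_directions {p : Space} (hp : p ∈ directions f) : -p ∈ directions f := by
  obtain ⟨x, hx, y, hy, hxy, rfl⟩ := hp
  refine ⟨y, hy, x, hx, hxy.symm, ?_⟩
  rw [norm_sub_rev, ← smul_neg, neg_sub]

lemma notMem_directions {p : Space} (h : lift (horiz p) 0 ∈ slopeEpigraph f) (hp : 0 < p 2) :
    p ∉ directions f := by
  rw [directions_eq]
  rintro ⟨-, hc⟩
  obtain ⟨-, q, t, ht, heq⟩ := mem_chordCone_graph.1 hc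
  have := h q t ht
  simp only [horiz_lift, lift_two_coord, mul_zero] at this
  have := mul_pos ht hp
  linarith

lemma horiz_of_mem_halfGreatCircle {p : Space} {x : Plane} (hp : p ∈ halfGreatCircle x) :
    ∃ r : ℝ, 0 ≤ r ∧ horiz p = r • x := by
  obtain ⟨-, r, hr, h0, h1⟩ := hp
  exact ⟨r, hr, plane_ext (by simpa using h0) (by simpa using h1)⟩

lemma lift_horiz_mem_of_mem_halfGreatCircle {p : Space} {x : Plane} (hx : x ∈ flatDirections f)
    (hp : p ∈ halfGreatCircle x) : lift (horiz p) 0 ∈ slopeEpigraph f := by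
  obtain ⟨r, hr, h⟩ := horiz_of_mem_halfGreatCircle hp
  have := smul_mem_slopeEpigraph hx.1 hr
  rw [smul_lift, mul_zero] at this
  rwa [h]

lemma normalize_lift_mem (hf : Continuous f) {x : Plane} (hx : x ∈ circle) {z : ℝ}
    (h : lift x z ∉ slopeEpigraph f) (h' : lift (-x) (-z) ∉ slopeEpigraph f) :
    ‖lift x z‖⁻¹ • lift x z ∈ directions f ∩ halfGreatCircle x := by
  have hx1 : ‖x‖ = 1 := by simpa [circle] using hx
  have h0 : lift x z ≠ 0 := by
    intro h0
    rw [lift_eq_zero] at h0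
    rw [h0.1, norm_zero] at hx1
    exact zero_ne_one hx1
  have hpos : 0 < ‖lift x z‖⁻¹ := inv_pos.2 (norm_pos_iff.2 h0)
  have hs : ‖lift x z‖⁻¹ • lift x z ∈ sphere := by
    simp [sphere, norm_smul, h0]
  refine ⟨mem_directions_of_notMem hf hs ?_ ?_, hs, ‖lift x z‖⁻¹, hpos.le, by simp, by simp⟩
  · rwa [smul_mem_slopeEpigraph_iff hpos]
  · rwa [← smul_neg, smul_mem_slopeEpigraph_iff hpos, neg_lift]

lemma IsPointed.neg_notMem_flatDirections (hP : IsPointed (slopeEpigraph f)) {x : Plane}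
    (hx : x ∈ flatDirections f) : lift (-x) 0 ∉ slopeEpigraph f := by
  intro h
  have := hP _ hx.1 (by simpa [neg_lift] using h)
  rw [lift_eq_zero] at this
  simpa [circle, this.1] using hx.2

/-- Points of the half circle below the equator belong to `directions f` and those above do not. The
supremum is 0 whether or not x itself belongs. -/
lemma topHeight_of_mem (hf : Continuous f) (hP : IsPointed (slopeEpigraph f))
    (hU : IsUpperProduct f) {x : Plane} (hx : x ∈ flatDirections f) : topHeight f x = 0 := by
  have hx1 : ‖x‖ = 1 := by simpa [circle] using hx.2
  have key : ∀ w : ℝ, w < 0 →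
      ∃ a ∈ (fun p : Space => p 2) '' (directions f ∩ halfGreatCircle x), w < a := by
    intro w hw
    -- The norm is at least 1, so normalizing leaves a height of at least w / 2 > w.
    have hmem := normalize_lift_mem hf hx.2 (z := w / 2)
      (fun h => by
        have := hU.nonneg _ h
        rw [lift_two_coord] at this
        linarith)
      (fun h => by
        have := hU.lift_horiz_mem _ h
        rw [horiz_lift] at this
        exact hP.neg_notMem_flatDirections hx this)
    refine ⟨_, ⟨_, hmem, rfl⟩, ?_⟩
    have hn := norm_lift_sq x (w / 2)
    have hn1 : 1 ≤ ‖lift x (w / 2)‖ := by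
      rw [hx1] at hn
      nlinarith [norm_nonneg (lift x (w / 2)), sq_nonneg (w / 2)]
    have hinv : ‖lift x (w / 2)‖⁻¹ ≤ 1 := inv_le_one_of_one_le₀ hn1
    simp only [PiLp.smul_apply, lift_two_coord, smul_eq_mul]
    nlinarith
  refine csSup_eq_of_forall_le_of_forall_lt_exists_gt ?_ ?_ key
  · obtain ⟨a, ha, -⟩ := key (-1) (by norm_num)
    exact ⟨a, ha⟩
  · rintro _ ⟨p, ⟨hpd, hph⟩, rfl⟩
    by_contra! hp
    exact notMem_directions (lift_horiz_mem_of_mem_halfGreatCircle hx hph) hp hpd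

lemma topHeight_of_notMem (hf : Continuous f) (hU : IsUpperProduct f) {x : Plane}
    (hxc : x ∈ circle) (hx : x ∉ flatDirections f) : topHeight f x = 1 := by
  have hx1 : ‖x‖ = 1 := by simpa [circle] using hxc
  have key : ∀ z : ℝ, 0 < z →
      ∃ a ∈ (fun p : Space => p 2) '' (directions f ∩ halfGreatCircle x), z / (1 + z) ≤ a := by
    intro z hz
    have hmem := normalize_lift_mem hf hxc (z := z)
      (fun h => by
        have := hU.lift_horiz_mem _ h
        rw [horiz_lift] at this
        exact hx ⟨this, hxc⟩)
      (fun h => by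
        have := hU.nonneg _ h
        rw [lift_two_coord] at this
        linarith)
    refine ⟨_, ⟨_, hmem, rfl⟩, ?_⟩
    have hn := norm_lift_sq x z
    rw [hx1] at hn
    have hn1 : ‖lift x z‖ ≤ 1 + z := by
      nlinarith [norm_nonneg (lift x z)]
    have hn0 : 0 < ‖lift x z‖ := by
      rcases (norm_nonneg (lift x z)).eq_or_lt with h | h
      · rw [← h] at hn; nlinarith
      · exact h
    simp only [PiLp.smul_apply, lift_two_coord, smul_eq_mul]
    rw [inv_mul_eq_div]
    exact div_le_div_of_nonneg_left hz.le hn0 hn1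
  refine csSup_eq_of_forall_le_of_forall_lt_exists_gt ?_ ?_ ?_
  · obtain ⟨a, ha, -⟩ := key 1 one_pos
    exact ⟨a, ha⟩
  · rintro _ ⟨p, ⟨-, hp, -⟩, rfl⟩
    have h1 : ‖p‖ = 1 := by simpa [sphere] using hp
    have h2 := norm_sq_space p
    rw [h1] at h2
    have h3 : p 2 ^ 2 ≤ 1 := by nlinarith [sq_nonneg ‖horiz p‖]
    exact (abs_le_one_iff_mul_self_le_one.2 (by nlinarith) |> abs_le.1).2
  · intro w hw
    -- This gives z(1 - w) ≥ 2 > w, that is, z / (1 + z) > w.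
    set z := max 1 (2 / (1 - w)) with hz
    have hz1 : 1 ≤ z := le_max_left _ _
    have hz2 : 2 / (1 - w) ≤ z := le_max_right _ _
    obtain ⟨a, ha, hza⟩ := key z (by linarith)
    refine ⟨a, ha, lt_of_lt_of_le ?_ hza⟩
    rw [div_le_iff₀ (by linarith)] at hz2
    rw [lt_div_iff₀ (by linarith)]
    nlinarith

lemma eq_northPole_of_horiz_eq_zero {p : Space} (hp : p ∈ sphere) (h : horiz p = 0)
    (h2 : 0 ≤ p 2) : p = northPole := by
  have h1 : ‖p‖ = 1 := by simpa [sphere] using hp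
  have h3 := norm_sq_space p
  rw [h1, h, norm_zero] at h3
  have h4 : p 2 = 1 := by nlinarith
  rw [northPole_eq, ← lift_horiz p, h, h4]

lemma northPole_notMem_directions : northPole ∉ directions f := by
  rw [northPole_eq]
  exact notMem_directions (by simpa using lift_zero_mem_slopeEpigraph (f := f) le_rfl) (by simp)

lemma normalize_horiz_mem (hU : IsUpperProduct f) {p : Space} (hp : p ∈ slopeEpigraph f)
    (h : horiz p ≠ 0) : ‖horiz p‖⁻¹ • horiz p ∈ flatDirections f := by
  refine ⟨?_, by simp [circle, norm_smul, h]⟩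
  have := smul_mem_slopeEpigraph (hU.lift_horiz_mem p hp) (inv_nonneg.2 (norm_nonneg (horiz p)))
  rwa [smul_lift, mul_zero] at this

lemma caseB_of_flatDirections_eq_empty (hf : Continuous f) (hU : IsUpperProduct f)
    (hJ : flatDirections f = ∅) : CaseB f := by
  have hE : ∀ p ∈ sphere, p ∈ slopeEpigraph f → p = northPole := by
    intro p hp hpE
    refine eq_northPole_of_horiz_eq_zero hp ?_ (hU.nonneg p hpE)
    by_contra h
    have := normalize_horiz_mem hU hpE h
    rw [hJ] at this
    exact this
  apply subset_antisymm
  · intro p hp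
    refine ⟨(directions_eq f ▸ hp).1, ?_⟩
    rintro (rfl | rfl)
    · exact northPole_notMem_directions hp
    · exact northPole_notMem_directions (by simpa using neg_mem_directions hp)
  · rintro p ⟨hp, hpN⟩
    simp only [Set.mem_insert_iff, Set.mem_singleton_iff, not_or] at hpN
    refine mem_directions_of_notMem hf hp (fun h => hpN.1 (hE p hp h)) fun h => hpN.2 ?_
    rw [← hE (-p) (by simpa [sphere] using hp) h, neg_neg]

lemma isSphereMinusQuarters_flatDirections (hf : Continuous f) (hU : IsUpperProduct f)
    (hJ : (flatDirections f).Nonempty) :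
    IsSphereMinusQuarters (directions f) (flatDirections f) := by
  have hE : ∀ p ∈ sphere, p ∈ slopeEpigraph f → p ∈ quarters (flatDirections f) := by
    intro p hp hpE
    refine ⟨hU.nonneg p hpE, ?_⟩
    by_cases h : horiz p = 0
    -- The pole lies on every quarter, so any flat direction serves, with radius 0.
    · obtain ⟨x, hx⟩ := hJ
      have h0 := congrArg (fun v : Plane => v 0) h
      have h1 := congrArg (fun v : Plane => v 1) h
      exact ⟨x, hx, hp, 0, le_rfl, by simpa using h0, by simpa using h1⟩
    · refine ⟨_, normalize_horiz_mem hU hpE h, hp, ‖horiz p‖, norm_nonneg _, ?_, ?_⟩ <;>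
        simp [mul_inv_cancel_left₀ (norm_ne_zero_iff.2 h)]
  have hO : ∀ p ∈ openQuarters (flatDirections f), p ∉ directions f := by
    rintro p ⟨hp, x, hx, hpx⟩
    exact notMem_directions (lift_horiz_mem_of_mem_halfGreatCircle hx hpx) hp
  constructor
  · rintro p ⟨hp, hpQ⟩
    rw [Set.mem_union, not_or] at hpQ
    exact mem_directions_of_notMem hf hp (fun h => hpQ.1 (hE p hp h)) fun h =>
      hpQ.2 (hE (-p) (by simpa [sphere] using hp) h)
  · intro p hp
    refine ⟨(directions_eq f ▸ hp).1, ?_⟩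
    rintro (h | h)
    · exact hO p h hp
    · exact hO (-p) h (neg_mem_directions hp)

lemma caseBCD (hf : Continuous f) (hP : IsPointed (slopeEpigraph f)) (hU : IsUpperProduct f) :
    CaseB f ∨ CaseC f ∨ CaseD f := by
  rcases (flatDirections f).eq_empty_or_nonempty with hJ | hJ
  · exact Or.inl (caseB_of_flatDirections_eq_empty hf hU hJ)
  right
  have hlc : Continuous fun x : Plane => lift x 0 :=
    continuous_lift.comp (continuous_id.prodMk continuous_const)
  obtain ⟨a, b, hab, hpi, heq⟩ := exists_circleArc_eq
    (P := {x | lift x 0 ∈ slopeEpigraph f}) ((isClosed_slopeEpigraph hf).preimage hlc)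
    (fun x hx y hy => by
      have := add_mem_slopeEpigraph hx hy
      rwa [lift_add, add_zero] at this)
    (fun x hx r hr => by
      have := smul_mem_slopeEpigraph hx hr
      rwa [smul_lift, mul_zero] at this)
    (fun x hx hxc => hP.neg_notMem_flatDirections ⟨hx, hxc⟩) hJ
  have heq : flatDirections f = circleArc a b := heq
  have hQ := isSphereMinusQuarters_flatDirections hf hU hJ
  rcases hab.eq_or_lt with h | h
  · left
    have hs : flatDirections f = {polar a} := by
      rw [heq, circleArc, ← sub_eq_zero.1 h.symm, Set.Icc_self, Set.image_singleton]
      rfl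
    refine ⟨polar a, polar_mem_circle a, topHeight_of_mem hf hP hU (by simp [hs]),
      fun x hx hxa => topHeight_of_notMem hf hU hx (by simpa [hs] using hxa), ?_⟩
    rwa [← hs]
  · right
    refine ⟨a, b, h, hpi, fun x hx => topHeight_of_mem hf hP hU (heq ▸ hx),
      fun x hx hxa => topHeight_of_notMem hf hU hx (heq ▸ hxa), ?_⟩
    rwa [← heq]

end
end VertRigid

theorem theoremt (C : Set ℝ) (hC : VertRigid.CondensatesToInfty C)
    (f : VertRigid.Plane → ℝ) (hf : Continuous f) (hrigid : VertRigid.VerticallyRigidFor f C) :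
    VertRigid.CaseA f ∨ VertRigid.CaseB f ∨ VertRigid.CaseC f ∨ VertRigid.CaseD f := by
  by_cases hA : VertRigid.CaseA f
  · exact Or.inl hA
  have hP := VertRigid.isPointed_slopeEpigraph hA
  obtain ⟨c, O, h⟩ := VertRigid.exists_congruentMultiples hC hf hP hrigid
  exact Or.inr (VertRigid.caseBCD hf hP
    ⟨fun _ => h.nonneg hf hP, fun _ => h.lift_horiz_mem hf hP⟩)
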